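/- Let $(E,\|\cdot\|)$ be a finite-dimensional real normed space. A curve $\theta\colon I\to E$, where $I\subset\mathbb{R}$ is a (possibly unbounded) interval, is not assumed to be continuous; it is called self-contracted if $\|\theta(t_3)-\theta(t_2)\|\le\|\theta(t_3)-\theta(t_1)\|$ for all $t_1\le t_2\le t_3$ in $I$. For a norm $N$ on $E$ write $\ell_N(\theta)=\sup\sum_{j=1}^{m-1}N(\theta(t_{j+1})-\theta(t_j))$, the supremum being over all finite families $t_1\le\dots\le t_m$ in $I$, and $\operatorname{diam}_N D=\sup\{N(x-y)\colon x,y\in D\}$ (with $\operatorname{diam}_N\emptyset=0$). (i) There is a constant $C>0$, depending only on $(E,\|\cdot\|)$, such that for every interval $I\subset\mathbb{R}$, every bounded set $D\subset E$ and every self-contracted curve $\theta\colon I\to E$ with $\theta(I)\subset D$, the length $\ell_{\|\cdot\|}(\theta)$ is finite and $\ell_{\|\cdot\|}(\theta)\le C\operatorname{diam}_{\|\cdot\|}D$. (ii) The same holds with Euclidean length and diameter: for every linear isomorphism $\varphi\colon E\to\mathbb{R}^n$, with $|\cdot|$ the Euclidean norm on $\mathbb{R}^n$ and $N(x)=|\varphi(x)|$,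 there is a constant $C>0$, depending only on $(E,\|\cdot\|)$ and $\varphi$, such that for every interval $I\subset\mathbb{R}$, every bounded set $D\subset E$ and every curve $\theta\colon I\to E$ that is self-contracted (with respect to $\|\cdot\|$) with $\theta(I)\subset D$, the length $\ell_N(\theta)$ is finite and $\ell_N(\theta)\le C\operatorname{diam}_N D$. In particular, if $E=\mathbb{R}^n$ with an arbitrary norm $\|\cdot\|$ and $\varphi$ is the identity, then $C$ depends only on $\|\cdot\|$ and $n$. -/

import Mathlib

/-- A curve `θ : T → X` (no continuity assumed) in a metric space is self-contracted if
`d(θ(t₃), θ(t₂)) ≤ d(θ(t₃), θ(t₁))` whenever `t₁ ≤ t₂ ≤ t₃`. -/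
def SelfContracted {T : Type*} [Preorder T] {X : Type*} [PseudoMetricSpace X]
    (θ : T → X) : Prop :=
  ∀ t₁ t₂ t₃ : T, t₁ ≤ t₂ → t₂ ≤ t₃ → dist (θ t₃) (θ t₂) ≤ dist (θ t₃) (θ t₁)

/-- The parametric length of a curve: the supremum, over all finite ordered sets of times, of the
length of the inscribed polygonal line, as an element of `[0, ∞]`. -/
noncomputable def curveLength {T : Type*} [LinearOrder T] {X : Type*} [PseudoEMetricSpace X]
    (θ : T → X) : ENNReal :=
  eVariationOn θ Set.univ

/-! Seen from `x k`, later points do not lie in opposing directions: a norming functional of `x j -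
x k` is nonnegative on `x i - x k` for `k < i ≤ j`, because `x i` is no farther from `x j` than `x
k` is. This triangular positivity limits cancellation, and Carathéodory bounds the number of terms,
so the hull of the directions avoids a ball of dimensional radius. Hahn–Banach then gives one
functional increasing from `x k` to all later points, and compactness of the dual ball reduces to a
finite set `P`. Each step raises the future minimum of some `p ∈ P` proportionally to its length,
while each such minimum is nondecreasing and grows by at most the diameter. -/

open Finset in
/-- If each `z i` has norm at most one and is normed by `g i`, and `g i` is nonnegative on the
vectors preceding `z i`, then nonnegative combinations of the `z i` do not cancel. -/
theorem sum_weights_le_of_triangular_functionals {E ι α : Type*} [NormedAddCommGroup E]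
    [NormedSpace ℝ E] [LinearOrder α] (k : ι → α) (z : ι → E) (g : ι → E →L[ℝ] ℝ) (w : ι → ℝ)
    (hz : ∀ i, ‖z i‖ ≤ 1) (hg : ∀ i, ‖g i‖ ≤ 1) (hgz : ∀ i, g i (z i) = 1)
    (hpos : ∀ i j, k i ≤ k j → 0 ≤ g j (z i)) (hw : ∀ i, 0 ≤ w i) (s : Finset ι) :
    ∑ i ∈ s, w i ≤ (2 ^ #s - 1) * ‖∑ i ∈ s, w i • z i‖ := by
  classical
  induction s using Finset.induction_on_max_value k with
  | empty => simp
  | insert a s has hmax ih =>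
    rw [sum_insert has, sum_insert has, card_insert_of_notMem has]
    set S := ∑ i ∈ s, w i • z i with hS
    have hgS : 0 ≤ g a S := by
      rw [hS, map_sum]
      refine sum_nonneg fun i hi => ?_
      rw [map_smul, smul_eq_mul]
      exact mul_nonneg (hw i) (hpos i a (hmax i hi))
    have hwa : w a ≤ ‖w a • z a + S‖ := by
      have h1 : g a (w a • z a + S) = w a + g a S := by simp [hgz]
      have h2 := (le_abs_self _).trans ((g a).le_of_opNorm_le (hg a) (w a • z a + S))
      linarith
    -- Each added vector turns the constant `m` into `2 * m + 1`, whence `2 ^ #s - 1`.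
    have hSle : ‖S‖ ≤ 2 * ‖w a • z a + S‖ := by
      have h1 : ‖S‖ ≤ ‖w a • z a + S‖ + ‖w a • z a‖ := by
        simpa using norm_sub_le (w a • z a + S) (w a • z a)
      have h2 : ‖w a • z a‖ ≤ w a := by
        rw [norm_smul, Real.norm_of_nonneg (hw a)]
        exact mul_le_of_le_one_right (hw a) (hz a)
      linarith
    have hpow : (0 : ℝ) ≤ 2 ^ #s - 1 := sub_nonneg.2 (one_le_pow₀ one_le_two)
    have := mul_le_mul_of_nonneg_left hSle hpow
    rw [pow_succ]
    linarith

/-- The convex hull of unit vectors admitting a triangular system of norming functionals stays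
away from the origin, by an amount depending only on the dimension. -/
theorem norm_ge_of_mem_convexHull_of_triangular_functionals {E ι : Type*} [NormedAddCommGroup E]
    [NormedSpace ℝ E] [FiniteDimensional ℝ E] [LinearOrder ι] (u : ι → E) (g : ι → E →L[ℝ] ℝ)
    (hu : ∀ i, ‖u i‖ ≤ 1) (hg : ∀ i, ‖g i‖ ≤ 1) (hgu : ∀ i, g i (u i) = 1)
    (hpos : ∀ i j, i ≤ j → 0 ≤ g j (u i)) {x : E} (hx : x ∈ convexHull ℝ (Set.range u)) :
    ((2 : ℝ) ^ (Module.finrank ℝ E + 1))⁻¹ ≤ ‖x‖ := by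
  -- Carathéodory: affinely independent `z`, so at most `finrank + 1` terms.
  obtain ⟨κ, _, z, w, hzs, hz, hw, hw1, rfl⟩ := eq_pos_convex_span_of_mem_convexHull hx
  choose k hk using fun i => hzs (Set.mem_range_self i)
  have h := sum_weights_le_of_triangular_functionals k z (fun i => g (k i)) w
    (fun i => hk i ▸ hu _) (fun i => hg _) (fun i => by rw [← hk i, hgu])
    (fun i j hij => by rw [← hk i]; exact hpos _ _ hij) (fun i => (hw i).le) Finset.univ
  rw [hw1, Finset.card_univ] at h
  have hcard : Fintype.card κ ≤ Module.finrank ℝ E + 1 :=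
    hz.card_le_finrank_succ.trans (by gcongr; exact Submodule.finrank_le _)
  have hpow : (2 : ℝ) ^ Fintype.card κ ≤ 2 ^ (Module.finrank ℝ E + 1) :=
    pow_le_pow_right₀ one_le_two hcard
  rw [inv_le_iff_one_le_mul₀' (by positivity)]
  refine h.trans (mul_le_mul_of_nonneg_right ?_ (norm_nonneg _))
  linarith

/-- A finite set whose convex hull avoids the ball of radius `δ` about the origin lies on the far
side of a functional of norm one. -/
theorem exists_functional_ge_of_convexHull {E : Type*} [NormedAddCommGroup E] [NormedSpace ℝ E]
    {s : Set E} {δ : ℝ} (hδ : 0 < δ) (hne : s.Nonempty)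
    (h : ∀ x ∈ convexHull ℝ s, δ ≤ ‖x‖) :
    ∃ f : E →L[ℝ] ℝ, ‖f‖ = 1 ∧ ∀ x ∈ s, δ ≤ f x := by
  obtain ⟨f, c, hfc, hcf⟩ := geometric_hahn_banach_open (convex_ball (0 : E) δ)
    Metric.isOpen_ball (convex_convexHull ℝ s) (Set.disjoint_left.2 fun x hx hx' => by
      rw [mem_ball_zero_iff] at hx
      exact (h x hx').not_gt hx)
  have hc : 0 < c := by simpa using hfc 0 (Metric.mem_ball_self hδ)
  have hnorm : ‖f‖ ≤ c / δ := by
    refine f.opNorm_le_of_unit_norm (by positivity) fun x hx => ?_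
    rw [le_div_iff₀ hδ]
    by_contra! hlt
    have hfx : f x ≠ 0 := fun h0 => by simp [h0] at hlt; linarith
    have := hfc ((c / f x) • x) (by
      rw [mem_ball_zero_iff, norm_smul, hx, mul_one, norm_div, Real.norm_of_nonneg hc.le,
        div_lt_iff₀ (norm_pos_iff.2 hfx), mul_comm]
      exact hlt)
    rw [map_smul, smul_eq_mul, div_mul_cancel₀ _ hfx] at this
    exact lt_irrefl _ this
  have hf0 : 0 < ‖f‖ := by
    obtain ⟨x, hx⟩ := hne
    refine norm_pos_iff.2 fun hf => ?_
    have := hcf x (subset_convexHull ℝ s hx)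
    rw [hf] at this
    simp at this
    linarith
  refine ⟨‖f‖⁻¹ • f, by rw [norm_smul, norm_inv, norm_norm, inv_mul_cancel₀ hf0.ne'],
    fun x hx => ?_⟩
  rw [smul_apply, smul_eq_mul, ← div_eq_inv_mul, le_div_iff₀ hf0]
  rw [le_div_iff₀ hδ] at hnorm
  have := hcf x (subset_convexHull ℝ s hx)
  linarith

/-- From any point of a self-contracted sequence, all later points are seen in directions on which
a single functional of norm one is bounded below. -/
theorem SelfContracted.exists_functional_ge {E : Type*} [NormedAddCommGroup E] [NormedSpace ℝ E]
    [FiniteDimensional ℝ E] {x : ℕ → E} (hx : SelfContracted x) {k : ℕ} (hk : x (k + 1) ≠ x k) :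
    ∃ f : E →L[ℝ] ℝ, ‖f‖ = 1 ∧ ∀ j, k < j →
      ((2 : ℝ) ^ (Module.finrank ℝ E + 1))⁻¹ * ‖x j - x k‖ ≤ f (x j - x k) := by
  have hne : ∀ j : Set.Ioi k, 0 < ‖x j - x k‖ := fun j => by
    -- A return to `x k` would force every point in between to equal it.
    refine norm_pos_iff.2 (sub_ne_zero.2 fun hj => hk ?_)
    have := hx k (k + 1) j k.le_succ j.2
    rw [hj, dist_self] at this
    exact (dist_le_zero.1 this).symm
  choose g hg hgx using fun j : Set.Ioi k =>
    exists_dual_vector ℝ (x j - x k) (hne j).ne'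
  obtain ⟨f, hf, hfx⟩ := exists_functional_ge_of_convexHull
    (s := Set.range fun j : Set.Ioi k => ‖x j - x k‖⁻¹ • (x j - x k))
    (δ := ((2 : ℝ) ^ (Module.finrank ℝ E + 1))⁻¹) (by positivity)
    (Set.range_nonempty_iff_nonempty.2 ⟨⟨k + 1, k.lt_succ_self⟩⟩)
    (fun y hy => norm_ge_of_mem_convexHull_of_triangular_functionals _ g
      (fun j => by rw [norm_smul, norm_inv, norm_norm, inv_mul_cancel₀ (hne j).ne'])
      (fun j => (hg j).le)
      (fun j => by rw [map_smul, hgx, smul_eq_mul]; exact inv_mul_cancel₀ (hne j).ne')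
      (fun i j hij => by
        rw [map_smul, smul_eq_mul]
        refine mul_nonneg (by positivity) ?_
        have h1 := hx k i j i.2.le hij
        rw [dist_eq_norm, dist_eq_norm] at h1
        have h2 := (le_abs_self _).trans ((g j).le_of_opNorm_le (hg j).le (x j - x i))
        have h3 : g j (x i - x k) = g j (x j - x k) - g j (x j - x i) := by
          rw [← map_sub]; congr 1; abel
        have h4 : g j (x j - x k) = ‖x j - x k‖ := hgx j
        linarith) hy)
  refine ⟨f, hf, fun j hj => ?_⟩
  have := hfx _ ⟨⟨j, hj⟩, rfl⟩
  rwa [map_smul, smul_eq_mul, ← div_eq_inv_mul, le_div_iff₀ (hne ⟨j, hj⟩)] at this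

/-- Finitely many functionals of norm at most one suffice to detect every step of every
self-contracted sequence. -/
theorem exists_finset_functionals_selfContracted (E : Type*) [NormedAddCommGroup E]
    [NormedSpace ℝ E] [FiniteDimensional ℝ E] :
    ∃ (P : Finset (E →L[ℝ] ℝ)) (c : ℝ), 0 < c ∧ (∀ p ∈ P, ‖p‖ ≤ 1) ∧
      ∀ x : ℕ → E, SelfContracted x → ∀ k, x (k + 1) ≠ x k → ∃ p ∈ P, ∀ j, k < j →
        c * ‖x (k + 1) - x k‖ ≤ p (x j - x k) := by
  set δ := ((2 : ℝ) ^ (Module.finrank ℝ E + 1))⁻¹ with hδ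
  have hδ0 : 0 < δ := by positivity
  have : ProperSpace (E →L[ℝ] ℝ) := FiniteDimensional.proper ℝ _
  obtain ⟨P, hP, hPfin, hPcov⟩ :=
    (isCompact_closedBall (0 : E →L[ℝ] ℝ) 1).finite_cover_balls (half_pos hδ0)
  -- Half of `δ` is lost to the net, another factor 2 to `h3`.
  refine ⟨hPfin.toFinset, δ / 4, by positivity, fun p hp => ?_, fun x hx k hk => ?_⟩
  · simpa using hP (hPfin.mem_toFinset.1 hp)
  obtain ⟨f, hf, hfx⟩ := hx.exists_functional_ge hk
  obtain ⟨p, hpP, hp⟩ := Set.mem_iUnion₂.1 (hPcov (show f ∈ _ by simp [hf]))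
  refine ⟨p, hPfin.mem_toFinset.2 hpP, fun j hj => ?_⟩
  rw [mem_ball_iff_norm] at hp
  have h1 := (le_abs_self _).trans ((f - p).le_of_opNorm_le hp.le (x j - x k))
  rw [sub_apply] at h1
  have h2 := hfx j hj
  rw [← hδ] at h2
  have h3 : ‖x (k + 1) - x k‖ ≤ 2 * ‖x j - x k‖ := by
    have h4 := hx k (k + 1) j k.le_succ hj
    have h5 := dist_triangle_left (x (k + 1)) (x k) (x j)
    rw [← dist_eq_norm, ← dist_eq_norm]
    linarith
  have h6 := mul_le_mul_of_nonneg_left h3 hδ0.le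
  linarith

/-- Bounded self-contracted sequences have bounded variation. -/
theorem exists_sum_dist_le_mul_diam_of_selfContracted (E : Type*) [NormedAddCommGroup E]
    [NormedSpace ℝ E] [FiniteDimensional ℝ E] :
    ∃ C : ℝ, 0 < C ∧ ∀ x : ℕ → E, SelfContracted x → ∀ D : Set E, Bornology.IsBounded D →
      Set.range x ⊆ D → ∀ n, ∑ i ∈ Finset.range n, dist (x (i + 1)) (x i) ≤ C * Metric.diam D := by
  obtain ⟨P, c, hc, hP, h⟩ := exists_finset_functionals_selfContracted E
  -- The `+ 1` keeps the constant positive even if `P` is empty.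
  refine ⟨(P.card + 1) / c, by positivity, fun x hx D hD hxD n => ?_⟩
  -- Minimum of `p` over the points from time `k` to `n`.
  set A : (E →L[ℝ] ℝ) → ℕ → ℝ := fun p k =>
    sInf ((fun j => p (x j)) '' Set.Icc k n) with hA
  have hbdd : ∀ p k, BddBelow ((fun j => (p : E →L[ℝ] ℝ) (x j)) '' Set.Icc k n) := fun p k =>
    ((Set.finite_Icc k n).image _).bddBelow
  have hAmono : ∀ p, ∀ k < n, A p k ≤ A p (k + 1) := fun p k hk =>
    csInf_le_csInf (hbdd p k) ((Set.nonempty_Icc.2 hk).image _)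
      (Set.image_mono (Set.Icc_subset_Icc_left k.le_succ))
  have hstep : ∀ k < n, c * dist (x (k + 1)) (x k) ≤ ∑ p ∈ P, (A p (k + 1) - A p k) := by
    intro k hk
    have hnonneg : ∀ p ∈ P, 0 ≤ A p (k + 1) - A p k := fun p _ => sub_nonneg.2 (hAmono p k hk)
    by_cases hxk : x (k + 1) = x k
    · rw [hxk, dist_self, mul_zero]
      exact Finset.sum_nonneg hnonneg
    obtain ⟨q, hqP, hq⟩ := h x hx k hxk
    refine le_trans ?_ (Finset.single_le_sum hnonneg hqP)
    have h1 : A q k ≤ q (x k) :=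
      csInf_le (hbdd _ _) ⟨k, Set.left_mem_Icc.2 hk.le, rfl⟩
    have h2 : q (x k) + c * dist (x (k + 1)) (x k) ≤ A q (k + 1) := by
      refine le_csInf ((Set.nonempty_Icc.2 hk).image _) ?_
      rintro _ ⟨j, hj, rfl⟩
      have := hq j hj.1
      rw [map_sub] at this
      rw [dist_eq_norm]
      linarith
    linarith
  have htotal : ∀ p ∈ P, A p n - A p 0 ≤ Metric.diam D := by
    intro p hp
    obtain ⟨j, -, hj⟩ := (((Set.nonempty_Icc.2 n.zero_le).image fun j => p (x j)).csInf_mem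
      ((Set.finite_Icc 0 n).image _))
    have h1 : A p n ≤ p (x n) := csInf_le (hbdd _ _) ⟨n, Set.right_mem_Icc.2 le_rfl, rfl⟩
    have h2 : A p 0 = p (x j) := hj.symm
    have h3 := (le_abs_self _).trans (p.le_of_opNorm_le (hP p hp) (x n - x j))
    rw [map_sub] at h3
    have h4 := Metric.dist_le_diam_of_mem hD (hxD (Set.mem_range_self n))
      (hxD (Set.mem_range_self j))
    rw [dist_eq_norm] at h4
    linarith
  have hsum : c * ∑ i ∈ Finset.range n, dist (x (i + 1)) (x i) ≤ P.card * Metric.diam D := by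
    rw [Finset.mul_sum]
    refine (Finset.sum_le_sum fun k hk => hstep k (Finset.mem_range.1 hk)).trans ?_
    rw [Finset.sum_comm]
    simp_rw [Finset.sum_range_sub]
    simpa using Finset.sum_le_sum htotal
  rw [div_mul_eq_mul_div, le_div_iff₀ hc]
  have := Metric.diam_nonneg (s := D)
  linarith

theorem SelfContracted.comp_monotone {S T X : Type*} [Preorder S] [Preorder T]
    [PseudoMetricSpace X] {θ : T → X} (hθ : SelfContracted θ) {u : S → T} (hu : Monotone u) :
    SelfContracted (θ ∘ u) :=
  fun _ _ _ h₁₂ h₂₃ => hθ _ _ _ (hu h₁₂) (hu h₂₃)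

/-- Bounded self-contracted curves have length at most a fixed multiple of the diameter. -/
theorem exists_curveLength_le_mul_diam_of_selfContracted (E : Type*) [NormedAddCommGroup E]
    [NormedSpace ℝ E] [FiniteDimensional ℝ E] :
    ∃ C : ℝ, 0 < C ∧ ∀ {T : Type} [LinearOrder T] (θ : T → E) (D : Set E),
      SelfContracted θ → Bornology.IsBounded D → Set.range θ ⊆ D →
        curveLength θ ≤ ENNReal.ofReal (C * Metric.diam D) := by
  obtain ⟨C, hC, h⟩ := exists_sum_dist_le_mul_diam_of_selfContracted E
  refine ⟨C, hC, fun θ D hθ hD hθD => iSup_le fun ⟨n, u, hu, _⟩ => ?_⟩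
  simp_rw [edist_dist]
  rw [← ENNReal.ofReal_sum_of_nonneg fun _ _ => dist_nonneg]
  exact ENNReal.ofReal_le_ofReal (h (θ ∘ u) (hθ.comp_monotone hu) D hD
    ((Set.range_comp_subset_range _ _).trans hθD) n)

/-- The first part measures length and diameter in the given norm of `E`; the second part measures
them in the Euclidean norm of any linear coordinates `φ` on `E` (self-contractedness always refers
to the given norm). -/
theorem mainTheorem2 {E : Type*} [NormedAddCommGroup E] [NormedSpace ℝ E]
    [FiniteDimensional ℝ E] :
    (∃ C : ℝ, 0 < C ∧
      ∀ (I : Set ℝ) (_ : I.OrdConnected) (θ : I → E) (D : Set E),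
        SelfContracted θ → Bornology.IsBounded D → Set.range θ ⊆ D →
          curveLength θ < ⊤ ∧ curveLength θ ≤ ENNReal.ofReal (C * Metric.diam D)) ∧
    (∀ (n : ℕ) (φ : E ≃ₗ[ℝ] EuclideanSpace ℝ (Fin n)),
      ∃ C : ℝ, 0 < C ∧
        ∀ (I : Set ℝ) (_ : I.OrdConnected) (θ : I → E) (D : Set E),
          SelfContracted θ → Bornology.IsBounded D → Set.range θ ⊆ D →
            curveLength (fun t => φ (θ t)) < ⊤ ∧
              curveLength (fun t => φ (θ t)) ≤ ENNReal.ofReal (C * Metric.diam (φ '' D))) := by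
  obtain ⟨C, hC, h⟩ := exists_curveLength_le_mul_diam_of_selfContracted E
  refine ⟨⟨C, hC, fun I _ θ D hθ hD hθD => ?_⟩, fun n φ => ?_⟩
  · have := h θ D hθ hD hθD
    exact ⟨this.trans_lt ENNReal.ofReal_lt_top, this⟩
  let ψ := φ.toContinuousLinearEquiv
  obtain ⟨K, hK⟩ : ∃ K, LipschitzWith K φ := ⟨_, ψ.lipschitz⟩
  obtain ⟨L, hL⟩ : ∃ L, LipschitzWith L φ.symm := ⟨_, ψ.symm.lipschitz⟩
  -- `K` or `L` may vanish, as when `E` is trivial; adding 1 keeps the constant positive.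
  refine ⟨(K + 1) * (C * (L + 1)), by positivity, fun I _ θ D hθ hD hθD => ?_⟩
  have hφD : Bornology.IsBounded (φ '' D) := hK.isBounded_image hD
  have hdiam : Metric.diam D ≤ (L + 1) * Metric.diam (φ '' D) := by
    have h1 := hL.diam_image_le (φ '' D) hφD
    rw [← Set.image_comp, show (φ.symm : _ → E) ∘ φ = id from funext φ.symm_apply_apply,
      Set.image_id] at h1
    have := Metric.diam_nonneg (s := φ '' D)
    linarith
  have hlen : curveLength (fun t => φ (θ t)) ≤
      ENNReal.ofReal ((K + 1) * (C * (L + 1)) * Metric.diam (φ '' D)) := by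
    calc curveLength (fun t => φ (θ t)) ≤ K * curveLength θ :=
          (hK.lipschitzOnWith (s := Set.univ)).comp_eVariationOn_le fun _ _ => Set.mem_univ _
      _ ≤ ENNReal.ofReal (K + 1) * ENNReal.ofReal (C * Metric.diam D) := by
          gcongr
          · rw [← ENNReal.ofReal_coe_nnreal]
            exact ENNReal.ofReal_le_ofReal (by linarith)
          · exact h θ D hθ hD hθD
      _ ≤ _ := by
          rw [← ENNReal.ofReal_mul (by positivity)]
          refine ENNReal.ofReal_le_ofReal ?_
          rw [mul_assoc, mul_assoc]
          gcongr
  exact ⟨hlen.trans_lt ENNReal.ofReal_lt_top, hlen⟩
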